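/- Let $E,F$ be complex Banach spaces, $U\subseteq E$ open, $v\colon U\to(0,\infty)$ continuous, and $p\in[1,\infty)$. Let $\mathcal H^\infty_v(U,F)$ be the space of holomorphic $f\colon U\to F$ with $\|f\|_v=\sup_{x\in U}v(x)\|f(x)\|<\infty$, and put $(vf)(U)=\{v(x)f(x):x\in U\}$. For a sequence $x=(x_n)$ in $F$ let $\|x\|_p=(\sum_n\|x_n\|^p)^{1/p}$ and $\|x\|_p^w=\sup_{\varphi\in B_{F^*}}(\sum_n|\varphi(x_n)|^p)^{1/p}$, and let $\ell_p(F)=\{x:\|x\|_p<\infty\}$, $\ell_p^w(F)=\{x:\|x\|_p^w<\infty\}$ and $\ell_p^u(F)=\{x\in\ell_p^w(F):\lim_m\|(x_n)_{n\ge m}\|_p^w=0\}$. Let $p\text{-}\mathrm{conv}(x)=\{\sum_n a_nx_n:(a_n)\in B\}$, where $B$ is the closed unit ball of $\ell_{p^*}$, $p^*=p/(p-1)$, if $p>1$, and of $c_0$ if $p=1$. A set $K\subseteq F$ is relatively $p$-compact (resp. relatively weakly $p$-compact, relatively unconditionally $p$-compact) if $K\subseteq p\text{-}\mathrm{conv}(x)$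 for some $x$ in $\ell_p(F)$ (resp. $\ell_p^w(F)$, $\ell_p^u(F)$). For $\mathcal I=\mathcal K_p$ (resp. $\mathcal K_{wp}$, $\mathcal K_{up}$) let $m_{\mathcal I}(K)\in[0,\infty]$ be the infimum of $\|x\|_p$ (resp. $\|x\|_p^w$, $\|x\|_p^w$) over all such $x$, with $\inf\emptyset=\infty$; let $\mathcal H^\infty_{v\mathcal I}(U,F)$ be the set of $f\in\mathcal H^\infty_v(U,F)$ for which $(vf)(U)$ is relatively $p$-compact (resp. relatively weakly $p$-compact, relatively unconditionally $p$-compact), and put $\|f\|_{\mathcal H^\infty_{v\mathcal I}}=m_{\mathcal I}((vf)(U))$ for every $f\in\mathcal H^\infty_v(U,F)$, which is finite exactly on $\mathcal H^\infty_{v\mathcal I}(U,F)$. Let $\mathcal H^\infty_{v\mathcal F}(U,F)$ be the set of $f\in\mathcal H^\infty_v(U,F)$ such that the linear span of $(vf)(U)$ is finite-dimensional, and let $\mathcal H^\infty_{v\overline{\mathcal F}^{\mathcal I}}(U,F)$ be the set of $p$-approximable (resp. $wp$-approximable, $up$-approximable) mappings: those $f\in\mathcal H^\infty_v(U,F)$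 for which there is a sequence $(f_n)$ in $\mathcal H^\infty_{v\mathcal F}(U,F)$ with $\|f_n-f\|_{\mathcal H^\infty_{v\mathcal I}}\to0$. Then, for each of $\mathcal I=\mathcal K_p,\mathcal K_{wp},\mathcal K_{up}$, $\mathcal H^\infty_{v\overline{\mathcal F}^{\mathcal I}}(U,F)\subseteq\mathcal H^\infty_{v\mathcal I}(U,F)$; that is, every $p$-approximable (resp. $wp$-approximable, $up$-approximable) mapping has relatively $p$-compact (resp. relatively weakly $p$-compact, relatively unconditionally $p$-compact) $v$-range. -/

import Mathlib

open Filter Topology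
open scoped ENNReal

/-! Sequence spaces and the three kinds of `p`-compact sets, for a real exponent `1 ≤ p`.
All norms take values in `[0, ∞]`, so that membership in a sequence space is finiteness
of the corresponding norm. -/

/-- `‖(xₙ)‖_p = (∑ ‖xₙ‖ ^ p) ^ (1 / p)`. -/
noncomputable def seqNorm {F : Type*} [NormedAddCommGroup F] (p : ℝ) (x : ℕ → F) : ℝ≥0∞ :=
  (∑' n, ‖x n‖ₑ ^ p) ^ (1 / p)

/-- `‖(xₙ)‖_p^w = sup { ‖(φ(xₙ))‖_p : φ in the closed unit ball of the dual of F }`. -/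
noncomputable def weakSeqNorm {F : Type*} [NormedAddCommGroup F] [NormedSpace ℂ F]
    (p : ℝ) (x : ℕ → F) : ℝ≥0∞ :=
  ⨆ (φ : StrongDual ℂ F) (_ : ‖φ‖ ≤ 1), seqNorm p (fun n => φ (x n))

/-- The three kinds of `p`-compactness: `p`-compact, weakly `p`-compact and unconditionally
`p`-compact. -/
inductive CompactKind where
  | strong
  | weak
  | unconditional

/-- The sequence spaces `ℓ_p(F)`, `ℓ_p^w(F)` and `ℓ_p^u(F)`. -/
def CompactKind.seqSpace (k : CompactKind) (p : ℝ) (F : Type*) [NormedAddCommGroup F]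
    [NormedSpace ℂ F] : Set (ℕ → F) :=
  match k with
  | .strong => {x | seqNorm p x < ∞}
  | .weak => {x | weakSeqNorm p x < ∞}
  | .unconditional => {x | weakSeqNorm p x < ∞ ∧
      Tendsto (fun m => weakSeqNorm p (fun n => x (n + m))) atTop (𝓝 0)}

/-- The norm of the sequence space: `‖·‖_p` on `ℓ_p(F)`, and `‖·‖_p^w` on `ℓ_p^w(F)`
and `ℓ_p^u(F)`. -/
noncomputable def CompactKind.norm (k : CompactKind) (p : ℝ) {F : Type*} [NormedAddCommGroup F]
    [NormedSpace ℂ F] (x : ℕ → F) : ℝ≥0∞ :=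
  match k with
  | .strong => seqNorm p x
  | .weak => weakSeqNorm p x
  | .unconditional => weakSeqNorm p x

/-- The closed unit ball of scalar coefficient sequences: that of `c₀` if `p = 1`, and that of
`ℓ_{p*}` with `p* = p / (p - 1)` if `p > 1`. -/
def coeffBall (p : ℝ) : Set (ℕ → ℂ) :=
  {a | (p = 1 → Tendsto a atTop (𝓝 0) ∧ ∀ n, ‖a n‖ ≤ 1) ∧
       (p ≠ 1 → seqNorm p.conjExponent a ≤ 1)}

/-- The `p`-convex hull `{∑ aₙ xₙ : (aₙ) in the coefficient ball}`. For `x` in any of the three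
sequence spaces the series converges unconditionally. -/
def pConv {F : Type*} [NormedAddCommGroup F] [NormedSpace ℂ F] (p : ℝ) (x : ℕ → F) : Set F :=
  {y | ∃ a ∈ coeffBall p, HasSum (fun n => a n • x n) y}

/-- `K` is relatively `p`-compact (weakly `p`-compact, unconditionally `p`-compact). -/
def CompactKind.IsRelCompact (k : CompactKind) (p : ℝ) {F : Type*} [NormedAddCommGroup F]
    [NormedSpace ℂ F] (K : Set F) : Prop :=
  ∃ x ∈ k.seqSpace p F, K ⊆ pConv p x

/-- The measure of the size of the compactness of `K`; it is `∞` exactly when `K` is not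
relatively compact of the kind `k`. -/
noncomputable def CompactKind.measure (k : CompactKind) (p : ℝ) {F : Type*}
    [NormedAddCommGroup F] [NormedSpace ℂ F] (K : Set F) : ℝ≥0∞ :=
  ⨅ (x : ℕ → F) (_ : x ∈ k.seqSpace p F) (_ : K ⊆ pConv p x), k.norm p x

theorem CompactKind.measure_lt_top_iff (k : CompactKind) (p : ℝ) {F : Type*}
    [NormedAddCommGroup F] [NormedSpace ℂ F] (K : Set F) :
    k.measure p K < ∞ ↔ k.IsRelCompact p K := by
  simp only [CompactKind.measure, CompactKind.IsRelCompact, iInf_lt_iff]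
  constructor
  · rintro ⟨x, hx, hK, -⟩
    exact ⟨x, hx, hK⟩
  · rintro ⟨x, hx, hK⟩
    refine ⟨x, hx, hK, ?_⟩
    cases k
    · exact hx
    · exact hx
    · exact hx.1

/-! Weighted holomorphic mappings. A mapping on the open set `U ⊆ E` is represented by a function
on `E`, of which only the values on `U` matter. -/

section WeightedHolomorphic

variable {E : Type*} [NormedAddCommGroup E] [NormedSpace ℂ E]

/-- `v` is a weight on `U`: continuous and strictly positive. -/
def IsWeight (U : Set E) (v : E → ℝ) : Prop :=
  ContinuousOn v U ∧ ∀ x ∈ U, 0 < v x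

/-- The `v`-range `(vf)(U)`. -/
def vRange {F : Type*} [NormedAddCommGroup F] [NormedSpace ℂ F]
    (U : Set E) (v : E → ℝ) (f : E → F) : Set F :=
  (fun x => (v x : ℂ) • f x) '' U

/-- `H_v^∞(U, F)`: holomorphic mappings with `sup_{x ∈ U} v(x) ‖f(x)‖ < ∞`. -/
def weightedHol (U : Set E) (v : E → ℝ) (F : Type*) [NormedAddCommGroup F] [NormedSpace ℂ F] :
    Set (E → F) :=
  {f | DifferentiableOn ℂ f U ∧ BddAbove ((fun x => v x * ‖f x‖) '' U)}

/-- `H_{vI}^∞(U, F)` for `I = K_p, K_{wp}, K_{up}`. -/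
def compactWeightedHol (k : CompactKind) (p : ℝ) (U : Set E) (v : E → ℝ) (F : Type*)
    [NormedAddCommGroup F] [NormedSpace ℂ F] : Set (E → F) :=
  {f | f ∈ weightedHol U v F ∧ k.IsRelCompact p (vRange U v f)}

/-- The norm of `H_{vI}^∞(U, F)`, with the value `∞` outside this space. -/
noncomputable def compactWeightedNorm (k : CompactKind) (p : ℝ) (U : Set E) (v : E → ℝ)
    {F : Type*} [NormedAddCommGroup F] [NormedSpace ℂ F] (f : E → F) : ℝ≥0∞ :=
  k.measure p (vRange U v f)

/-- `H_{vF}^∞(U, F)`: weighted holomorphic mappings with finite-dimensional `v`-rank. -/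
def finiteRankWeightedHol (U : Set E) (v : E → ℝ) (F : Type*) [NormedAddCommGroup F]
    [NormedSpace ℂ F] : Set (E → F) :=
  {f | f ∈ weightedHol U v F ∧ FiniteDimensional ℂ (Submodule.span ℂ (vRange U v f))}

/-- The `p`-approximable (`wp`-approximable, `up`-approximable) weighted holomorphic mappings.
It is not demanded that `f` itself has a relatively compact `v`-range of the kind `k`;
convergence to `0` in `[0, ∞]` forces `fₙ - f` to have one for all large `n`. -/
def approximableWeightedHol (k : CompactKind) (p : ℝ) (U : Set E) (v : E → ℝ) (F : Type*)
    [NormedAddCommGroup F] [NormedSpace ℂ F] : Set (E → F) :=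
  {f | f ∈ weightedHol U v F ∧ ∃ g : ℕ → E → F, (∀ n, g n ∈ finiteRankWeightedHol U v F) ∧
    Tendsto (fun n => compactWeightedNorm k p U v (g n - f)) atTop (𝓝 0)}

end WeightedHolomorphic

/-! A single good approximant suffices. Convergence to `0` in `[0, ∞]` makes the measure of the
`v`-range of `g n - f` finite for some `n`, so that range is relatively compact of kind `k`. Since
`v f = v (g n) - v (g n - f)` pointwise, the `v`-range of `f` lies in a sum of two relatively
compact sets, once the following are known: bounded sets of finite-dimensional span are relatively
compact (`isRelCompact_of_finiteDimensional_span`), and relative compactness survives negation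
(`IsRelCompact.exists_neg`) and addition (`IsRelCompact.image2_add`). Addition is the main point:
the two defining sequences are interleaved into one. -/

section SeqNorm

variable {F : Type*} [NormedAddCommGroup F]

theorem seqNorm_mono {G : Type*} [NormedAddCommGroup G] {p : ℝ} (hp : 0 ≤ p) {x : ℕ → F}
    {y : ℕ → G} (h : ∀ n, ‖x n‖ₑ ≤ ‖y n‖ₑ) : seqNorm p x ≤ seqNorm p y :=
  ENNReal.rpow_le_rpow (ENNReal.tsum_le_tsum fun n => ENNReal.rpow_le_rpow (h n) hp)
    (by positivity)

theorem seqNorm_single {p : ℝ} (hp : 0 < p) (b : F) : seqNorm p (Pi.single 0 b) = ‖b‖ₑ := by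
  rw [seqNorm, tsum_eq_single 0, Pi.single_eq_same, ← ENNReal.rpow_mul, mul_one_div_cancel hp.ne',
    ENNReal.rpow_one]
  intro n hn
  rw [Pi.single_eq_of_ne hn, enorm_zero, ENNReal.zero_rpow_of_pos hp]

theorem seqNorm_zero {p : ℝ} (hp : 0 < p) : seqNorm p (fun _ => (0 : F)) = 0 := by
  simp [seqNorm, ENNReal.zero_rpow_of_pos, hp]

theorem seqNorm_smul [NormedSpace ℂ F] {p : ℝ} (hp : 0 < p) (c : ℂ) (x : ℕ → F) :
    seqNorm p (fun n => c • x n) = ‖c‖ₑ * seqNorm p x := by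
  simp only [seqNorm, enorm_smul, ENNReal.mul_rpow_of_nonneg _ _ hp.le, ENNReal.tsum_mul_left]
  rw [ENNReal.mul_rpow_of_nonneg _ _ (by positivity), ← ENNReal.rpow_mul,
    mul_one_div_cancel hp.ne', ENNReal.rpow_one]

theorem seqNorm_tail_antitone {p : ℝ} (hp : 0 ≤ p) (x : ℕ → F) :
    Antitone fun m => seqNorm p fun n => x (n + m) := by
  intro m l hml
  obtain ⟨d, rfl⟩ := Nat.exists_eq_add_of_le' hml
  refine ENNReal.rpow_le_rpow ?_ (by positivity)
  simpa only [Function.comp_def, add_assoc] using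
    ENNReal.tsum_comp_le_tsum_of_injective (add_left_injective d)
    (fun n => ‖x (n + m)‖ₑ ^ p)

/-- The sequence `x 0, y 0, x 1, y 1, …`. -/
def interleave {α : Type*} (x y : ℕ → α) (n : ℕ) : α :=
  if Even n then x (n / 2) else y (n / 2)

@[simp] theorem interleave_two_mul {α : Type*} (x y : ℕ → α) (n : ℕ) :
    interleave x y (2 * n) = x n := by
  simp [interleave]

@[simp] theorem interleave_two_mul_add_one {α : Type*} (x y : ℕ → α) (n : ℕ) :
    interleave x y (2 * n + 1) = y n := by
  have : (2 * n + 1) / 2 = n := by omega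
  simp [interleave, this]

theorem map_interleave {α β : Type*} (f : α → β) (x y : ℕ → α) (n : ℕ) :
    f (interleave x y n) = interleave (fun n => f (x n)) (fun n => f (y n)) n :=
  apply_ite f _ _ _

theorem interleave_add_two_mul {α : Type*} (x y : ℕ → α) (n m : ℕ) :
    interleave x y (n + 2 * m) =
      interleave (fun n => x (n + m)) (fun n => y (n + m)) n := by
  have : (n + 2 * m) / 2 = n / 2 + m := by omega
  simp [interleave, this, Nat.even_add]

/-- The sums of `p`-th powers add exactly, and `t ↦ t ^ (1 / p)` is subadditive for `p ≥ 1`. -/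
theorem seqNorm_interleave_le {p : ℝ} (hp : 1 ≤ p) (x y : ℕ → F) :
    seqNorm p (interleave x y) ≤ seqNorm p x + seqNorm p y := by
  have h := tsum_even_add_odd (f := fun n => ‖interleave x y n‖ₑ ^ p) ENNReal.summable
    ENNReal.summable
  simp only [interleave_two_mul, interleave_two_mul_add_one] at h
  rw [seqNorm, ← h]
  exact ENNReal.rpow_add_le_add_rpow _ _ (by positivity) (div_le_one_of_le₀ hp (by positivity))

end SeqNorm

section WeakSeqNorm

variable {F : Type*} [NormedAddCommGroup F] [NormedSpace ℂ F]

theorem weakSeqNorm_le_seqNorm {p : ℝ} (hp : 0 ≤ p) (x : ℕ → F) :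
    weakSeqNorm p x ≤ seqNorm p x := by
  refine iSup₂_le fun φ hφ => seqNorm_mono hp fun n => ?_
  rw [enorm_le_iff_norm_le]
  simpa using φ.le_of_opNorm_le hφ (x n)

theorem weakSeqNorm_smul {p : ℝ} (hp : 0 < p) (c : ℂ) (x : ℕ → F) :
    weakSeqNorm p (fun n => c • x n) = ‖c‖ₑ * weakSeqNorm p x := by
  simp only [weakSeqNorm, map_smul, seqNorm_smul hp, ENNReal.mul_iSup]

theorem weakSeqNorm_tail_antitone {p : ℝ} (hp : 0 ≤ p) (x : ℕ → F) :
    Antitone fun m => weakSeqNorm p fun n => x (n + m) := fun _ _ h =>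
  iSup₂_mono fun φ _ => seqNorm_tail_antitone hp (fun n => φ (x n)) h

theorem weakSeqNorm_interleave_le {p : ℝ} (hp : 1 ≤ p) (x y : ℕ → F) :
    weakSeqNorm p (interleave x y) ≤ weakSeqNorm p x + weakSeqNorm p y := by
  refine iSup₂_le fun φ hφ => ?_
  simp only [map_interleave φ]
  exact (seqNorm_interleave_le hp _ _).trans
    (add_le_add (le_iSup₂_of_le φ hφ le_rfl) (le_iSup₂_of_le φ hφ le_rfl))

end WeakSeqNorm

section CoeffBall

theorem one_le_conjExponent {p : ℝ} (hp : 1 ≤ p) (hp1 : p ≠ 1) : 1 ≤ p.conjExponent :=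
  (Real.HolderConjugate.conjExponent (lt_of_le_of_ne hp hp1.symm)).symm.lt.le

theorem neg_mem_coeffBall {p : ℝ} {a : ℕ → ℂ} (ha : a ∈ coeffBall p) :
    (fun n => -a n) ∈ coeffBall p := by
  refine ⟨fun h => ⟨by simpa using (ha.1 h).1.neg, by simpa using (ha.1 h).2⟩, fun h => ?_⟩
  simpa only [seqNorm, enorm_neg] using ha.2 h

theorem single_mem_coeffBall {p : ℝ} (hp : 1 ≤ p) {c : ℂ} (hc : ‖c‖ ≤ 1) :
    Pi.single 0 c ∈ coeffBall p := by
  refine ⟨fun _ => ⟨?_, fun n => ?_⟩, fun h => ?_⟩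
  · refine tendsto_const_nhds.congr' ?_
    filter_upwards [eventually_ne_atTop 0] with n hn
    exact (Pi.single_eq_of_ne (M := fun _ : ℕ => ℂ) hn c).symm
  · rcases eq_or_ne n 0 with rfl | hn
    · simpa using hc
    · simp [Pi.single_eq_of_ne hn]
  · rw [seqNorm_single (by linarith [one_le_conjExponent hp h])]
    simpa using enorm_le_iff_norm_le (y := (1 : ℂ)).2 (by simpa using hc)

/-- For `p > 1` the factors `1/2` bring the sum of the two norms back to at most `1`; for `p = 1`
they are harmless. -/
theorem interleave_half_mem_coeffBall {p : ℝ} (hp : 1 ≤ p) {a b : ℕ → ℂ} (ha : a ∈ coeffBall p)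
    (hb : b ∈ coeffBall p) :
    interleave (fun n => (2⁻¹ : ℂ) • a n) (fun n => (2⁻¹ : ℂ) • b n) ∈ coeffBall p := by
  refine ⟨fun h => ⟨?_, fun n => ?_⟩, fun h => ?_⟩
  · have hdiv : Tendsto (fun n : ℕ => n / 2) atTop atTop := Nat.tendsto_div_const_atTop two_ne_zero
    have ha' := ((ha.1 h).1.const_smul (2⁻¹ : ℂ)).comp hdiv
    have hb' := ((hb.1 h).1.const_smul (2⁻¹ : ℂ)).comp hdiv
    rw [smul_zero] at ha' hb'
    exact ha'.if' hb'
  · have ha' := (ha.1 h).2 (n / 2)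
    have hb' := (hb.1 h).2 (n / 2)
    unfold interleave
    split_ifs <;> rw [norm_smul, norm_inv, Complex.norm_ofNat] <;> linarith
  · have hq := one_le_conjExponent hp h
    have h2 : ‖(2⁻¹ : ℂ)‖ₑ = 2⁻¹ := by
      rw [enorm_inv two_ne_zero, ← ofReal_norm, Complex.norm_ofNat, ENNReal.ofReal_ofNat]
    refine (seqNorm_interleave_le hq _ _).trans ?_
    rw [seqNorm_smul (by linarith), seqNorm_smul (by linarith), h2, ← ENNReal.inv_two_add_inv_two]
    exact add_le_add (mul_le_of_le_one_right' (ha.2 h)) (mul_le_of_le_one_right' (hb.2 h))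

end CoeffBall

/-! ### Stability properties of the three kinds of relative compactness. -/

namespace CompactKind

variable {F : Type*} [NormedAddCommGroup F] [NormedSpace ℂ F] {k : CompactKind} {p : ℝ}

theorem single_mem_seqSpace (hp : 0 < p) (b : F) : Pi.single 0 b ∈ k.seqSpace p F := by
  have hs : seqNorm p (Pi.single 0 b : ℕ → F) < ∞ := by
    rw [seqNorm_single hp]
    exact enorm_lt_top
  have hw := (weakSeqNorm_le_seqNorm hp.le _).trans_lt hs
  cases k
  · exact hs
  · exact hw
  · refine ⟨hw, tendsto_const_nhds.congr' ?_⟩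
    filter_upwards [eventually_ne_atTop 0] with m hm
    have : (fun n => (Pi.single 0 b : ℕ → F) (n + m)) = fun _ => 0 :=
      funext fun n => Pi.single_eq_of_ne (M := fun _ : ℕ => F) (by omega : n + m ≠ 0) b
    rw [this]
    exact (le_antisymm ((weakSeqNorm_le_seqNorm hp.le _).trans_eq (seqNorm_zero hp)) zero_le).symm

theorem smul_mem_seqSpace (hp : 0 < p) (c : ℂ) {x : ℕ → F} (hx : x ∈ k.seqSpace p F) :
    (fun n => c • x n) ∈ k.seqSpace p F := by
  have hc : ‖c‖ₑ < ∞ := enorm_lt_top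
  cases k
  · exact (seqNorm_smul hp c x).trans_lt (ENNReal.mul_lt_top hc hx)
  · exact (weakSeqNorm_smul hp c x).trans_lt (ENNReal.mul_lt_top hc hx)
  · refine ⟨(weakSeqNorm_smul hp c x).trans_lt (ENNReal.mul_lt_top hc hx.1), ?_⟩
    have := ENNReal.Tendsto.const_mul hx.2 (Or.inr hc.ne)
    rw [mul_zero] at this
    exact this.congr fun m => (weakSeqNorm_smul hp c _).symm

theorem interleave_mem_seqSpace (hp : 1 ≤ p) {x y : ℕ → F} (hx : x ∈ k.seqSpace p F)
    (hy : y ∈ k.seqSpace p F) : interleave x y ∈ k.seqSpace p F := by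
  cases k
  · exact (seqNorm_interleave_le hp x y).trans_lt (ENNReal.add_lt_top.2 ⟨hx, hy⟩)
  · exact (weakSeqNorm_interleave_le hp x y).trans_lt (ENNReal.add_lt_top.2 ⟨hx, hy⟩)
  · refine ⟨(weakSeqNorm_interleave_le hp x y).trans_lt (ENNReal.add_lt_top.2 ⟨hx.1, hy.1⟩), ?_⟩
    have h := (hx.2.add hy.2).comp (Nat.tendsto_div_const_atTop two_ne_zero)
    rw [add_zero] at h
    refine tendsto_of_tendsto_of_tendsto_of_le_of_le tendsto_const_nhds h (fun _ => zero_le)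
      fun m => ?_
    -- Cutting at the even index `2 * (m / 2) ≤ m` gives a larger tail, which is an interleaving of
    -- two tails.
    refine (weakSeqNorm_tail_antitone (by linarith) _ (Nat.mul_div_le m 2)).trans ?_
    simp only [interleave_add_two_mul]
    exact weakSeqNorm_interleave_le hp _ _

theorem IsRelCompact.mono {K L : Set F} (hL : k.IsRelCompact p L) (h : K ⊆ L) :
    k.IsRelCompact p K :=
  hL.imp fun _ hx => ⟨hx.1, h.trans hx.2⟩

/-- The coefficient ball is symmetric, so the whole `p`-convex hull serves as `L`. -/
theorem IsRelCompact.exists_neg {K : Set F} (hK : k.IsRelCompact p K) :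
    ∃ L, k.IsRelCompact p L ∧ ∀ y ∈ K, -y ∈ L := by
  obtain ⟨x, hx, hKx⟩ := hK
  refine ⟨pConv p x, ⟨x, hx, subset_rfl⟩, fun y hy => ?_⟩
  obtain ⟨a, ha, hay⟩ := hKx hy
  exact ⟨_, neg_mem_coeffBall ha, by simpa only [neg_smul] using hay.neg⟩

/-- Doubling the vectors compensates for halving the coefficients, so the even and odd terms sum to
the two summands. -/
theorem IsRelCompact.image2_add (hp : 1 ≤ p) {K L : Set F} (hK : k.IsRelCompact p K)
    (hL : k.IsRelCompact p L) : k.IsRelCompact p (Set.image2 (· + ·) K L) := by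
  obtain ⟨x, hx, hKx⟩ := hK
  obtain ⟨y, hy, hLy⟩ := hL
  have hp0 : 0 < p := by linarith
  refine ⟨interleave (fun n => (2 : ℂ) • x n) (fun n => (2 : ℂ) • y n),
    interleave_mem_seqSpace hp (smul_mem_seqSpace hp0 2 hx) (smul_mem_seqSpace hp0 2 hy), ?_⟩
  rintro _ ⟨s, hs, t, ht, rfl⟩
  obtain ⟨a, ha, has⟩ := hKx hs
  obtain ⟨b, hb, hbt⟩ := hLy ht
  have h2 (c : ℂ) : 2⁻¹ * c * 2 = c := by ring
  refine ⟨_, interleave_half_mem_coeffBall hp ha hb, HasSum.even_add_odd ?_ ?_⟩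
  · simpa [smul_smul, h2] using has
  · simpa [smul_smul, h2] using hbt

theorem isRelCompact_disc (hp : 1 ≤ p) (C : ℝ) (b : F) :
    k.IsRelCompact p {y | ∃ c : ℂ, ‖c‖ ≤ C ∧ c • b = y} := by
  refine ⟨Pi.single 0 ((C : ℂ) • b), single_mem_seqSpace (by linarith) _, ?_⟩
  rintro _ ⟨c, hc, rfl⟩
  have hC : 0 ≤ C := (norm_nonneg c).trans hc
  refine ⟨Pi.single 0 (c / C), single_mem_coeffBall hp ?_, ?_⟩
  · rw [norm_div, Complex.norm_real, Real.norm_of_nonneg hC]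
    exact div_le_one_of_le₀ hc hC
  · have hcb : c • b = (Pi.single 0 (c / C) : ℕ → ℂ) 0 •
        (Pi.single 0 ((C : ℂ) • b) : ℕ → F) 0 := by
      rw [Pi.single_eq_same, Pi.single_eq_same, smul_smul]
      -- If `C = 0`, then `c = 0`, in agreement with the convention `c / 0 = 0`.
      rcases hC.eq_or_lt with rfl | hC
      · simp [norm_le_zero_iff.1 hc]
      · rw [div_mul_cancel₀ _ (by exact_mod_cast hC.ne')]
    rw [hcb]
    exact hasSum_single 0 fun n hn => by rw [Pi.single_eq_of_ne hn, zero_smul]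

theorem isRelCompact_sum_disc (hp : 1 ≤ p) {ι : Type*} (s : Finset ι) (C : ℝ) (b : ι → F) :
    k.IsRelCompact p {y | ∃ c : ι → ℂ, (∀ i, ‖c i‖ ≤ C) ∧ ∑ i ∈ s, c i • b i = y} := by
  classical
  induction s using Finset.induction_on with
  | empty =>
    refine (isRelCompact_disc hp 0 (0 : F)).mono ?_
    rintro _ ⟨c, -, rfl⟩
    exact ⟨0, by simp⟩
  | insert i s hi ih =>
    refine ((isRelCompact_disc hp C (b i)).image2_add hp ih).mono ?_
    rintro _ ⟨c, hc, rfl⟩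
    rw [Finset.sum_insert hi]
    exact ⟨_, ⟨c i, hc i, rfl⟩, _, ⟨c, hc, rfl⟩, rfl⟩

/-- Bounded subsets of finite-dimensional subspaces are relatively compact of every kind. -/
theorem isRelCompact_of_finiteDimensional_span (hp : 1 ≤ p) {K : Set F}
    [FiniteDimensional ℂ (Submodule.span ℂ K)] {M : ℝ} (hM : ∀ y ∈ K, ‖y‖ ≤ M) :
    k.IsRelCompact p K := by
  let b := Module.finBasis ℂ (Submodule.span ℂ K)
  -- Coordinates are continuous in finite dimension, so on `K` they are all bounded by `‖T‖ * M`.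
  let T : Submodule.span ℂ K →L[ℂ] (Fin _ → ℂ) := b.equivFun.toLinearMap.toContinuousLinearMap
  refine (isRelCompact_sum_disc hp Finset.univ (‖T‖ * M) fun i => (b i : F)).mono fun y hy => ?_
  let z : Submodule.span ℂ K := ⟨y, Submodule.subset_span hy⟩
  refine ⟨T z, fun i => (norm_le_pi_norm (T z) i).trans
    ((T.le_opNorm z).trans (mul_le_mul_of_nonneg_left (hM y hy) (norm_nonneg T))), ?_⟩
  have h := congrArg (Submodule.subtype _) (b.sum_equivFun z)
  rw [map_sum] at h
  exact h

end CompactKind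

theorem isRelCompact_vRange_of_finiteRank {E F : Type*} [NormedAddCommGroup E] [NormedSpace ℂ E]
    [NormedAddCommGroup F] [NormedSpace ℂ F] {U : Set E} {v : E → ℝ} (hv : ∀ x ∈ U, 0 < v x)
    {p : ℝ} (hp : 1 ≤ p) (k : CompactKind) {g : E → F} (hg : g ∈ finiteRankWeightedHol U v F) :
    k.IsRelCompact p (vRange U v g) := by
  obtain ⟨⟨-, M, hM⟩, hfin⟩ := hg
  refine CompactKind.isRelCompact_of_finiteDimensional_span hp (M := M) ?_
  rintro _ ⟨x, hx, rfl⟩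
  rw [norm_smul, Complex.norm_real, Real.norm_of_nonneg (hv x hx).le]
  exact hM ⟨x, hx, rfl⟩

theorem mainTheorem9 {E F : Type*} [NormedAddCommGroup E] [NormedSpace ℂ E] [CompleteSpace E]
    [NormedAddCommGroup F] [NormedSpace ℂ F] [CompleteSpace F]
    (U : Set E) (hU : IsOpen U) (v : E → ℝ) (hv : IsWeight U v) (p : ℝ) (hp : 1 ≤ p)
    (k : CompactKind) :
    approximableWeightedHol k p U v F ⊆ compactWeightedHol k p U v F := by
  rintro f ⟨hf, g, hg, hlim⟩
  obtain ⟨n, hn⟩ := (hlim.eventually_lt_const ENNReal.zero_lt_top).exists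
  obtain ⟨L, hL, hneg⟩ := ((k.measure_lt_top_iff p _).1 hn).exists_neg
  refine ⟨hf, ((isRelCompact_vRange_of_finiteRank hv.2 hp k (hg n)).image2_add hp hL).mono ?_⟩
  rintro _ ⟨x, hx, rfl⟩
  -- Both summands are taken at the same point `x`.
  refine ⟨_, ⟨x, hx, rfl⟩, _, hneg _ ⟨x, hx, rfl⟩, ?_⟩
  simp only [Pi.sub_apply, smul_sub]
  abel
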